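/- Consider a single-server FCFS Markovian queue. Potential customers arrive in a Poisson process of rate $\lambda>0$; when $m$ customers are present the service rate is $\mu_m=\mu_l$ if $m\le T$ and $\mu_m=\mu_h$ if $m>T$, where $T\ge 1$ is an integer and $0<\mu_l<\mu_h$. Each customer observes the number present on arrival and joins or balks; joining brings a reward $R\ge 0$ and costs $C>0$ per unit of time in the system. Put $\tilde R=R/C$. A strategy is a sequence $p=(p_0,p_1,\dots)\in[0,1]^{\infty}$, with $p_n$ the probability of joining when $n$ customers are found. Let $W(n,m;p)$, $n<m$, be the expected remaining time in the system of a tagged customer who has $n$ customers in front of her, when $m$ customers in total are present and all future arrivals follow $p$; that is, the expected absorption time of the continuous-time Markov chain which from $(n,m)$ jumps to $(n,m+1)$ at rate $\lambda p_m$ and, at rate $\mu_m$, to $(n-1,m-1)$ if $n\ge1$ and to absorption if $n=0$. Let $W(n;p)=W(n,n+1;p)$. If $p_n=0$ for some $n$, let $n_0(p)=\min\{n:p_n=0\}$; $p$ is a (recurrent class) equilibrium if such an $n$ exists and, for every $n\le n_0(p)$: $\tilde R\le W(n;p)$ if $p_n=0$, $\tilde R\ge W(n;p)$ if $p_n=1$,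 and $\tilde R=W(n;p)$ if $0<p_n<1$. The pure threshold strategy $\tilde p(n_0)$ has $p_n=1$ for $n<n_0$ and $p_n=0$ for $n\ge n_0$. For real $x>0$ the mixed threshold strategy $\hat p(x)$ has $p_n=1$ for $n<\lfloor x\rfloor$, $p_{\lfloor x\rfloor}=x-\lfloor x\rfloor$, and $p_n=0$ for $n>\lfloor x\rfloor$. Then the following hold. (1) Let $\hat n_0-1\ge T+1$, and let $\tilde p(\hat n_0-1)$ and $\tilde p(\hat n_0)$ both be equilibria. If $$W\bigl(\hat n_0-2,\hat n_0-1;\tilde p(\hat n_0-1)\bigr)>\tilde R-\frac1{\mu_h}\qquad\text{and}\qquad W\bigl(\hat n_0-1,\hat n_0;\tilde p(\hat n_0)\bigr)<\tilde R,$$ then there is an $x\in(\hat n_0-1,\hat n_0)$ such that $\hat p(x)$ is an equilibrium. (2) If $\tilde R\mu_l$ is a positive integer and $\tilde R\mu_l\le T$, then $\hat p(x)$ is an equilibrium for every $x\in(\tilde R\mu_l-1,\tilde R\mu_l)$. -/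

import Mathlib

namespace ObservableQueue

noncomputable section

open MeasureTheory ProbabilityTheory
open scoped ENNReal unitInterval

/-! ### The queue as seen by a tagged customer

Potential customers arrive at rate `lam`, the service rate is `mu m` when `m` customers are
present, service is FCFS, and a customer who finds `m` customers joins with probability `p m`.
A tagged customer who is in the system has `n` customers in front and `m` customers in total
(herself included) are present, so `n < m`; every later arrival joins behind her. -/

/-- State of a tagged customer: `some (n, m)` while she is in the system (`n` customers in front
of her, `m` in total), `none` after her departure. -/
abbrev TaggedState := Option (ℕ × ℕ)

/-- Total rate out of a state with `m` customers present: joining arrivals plus services. -/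
def totalRate (lam : ℝ) (mu p : ℕ → ℝ) (m : ℕ) : ℝ := lam * p m + mu m

/-- One jump of the Markov chain of the tagged customer, driven by a uniform variable `u`.
From `(n, m)` a new customer joins with probability `lam * p m / (lam * p m + mu m)`; otherwise
a service is completed, and the tagged customer leaves if she was the one in service. -/
def jump (lam : ℝ) (mu p : ℕ → ℝ) (u : I) : TaggedState → TaggedState
  | none => none
  | some (n, m) =>
      if (u : ℝ) < lam * p m / totalRate lam mu p m then some (n, m + 1)
      else if n = 0 then none
      else some (n - 1, m - 1)

/-- Randomness of the chain: for each jump, a standard exponential variable for the holding time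
and a uniform variable for the direction of the jump. -/
abbrev Noise := ℕ → ℝ × I

/-- All these variables are independent. -/
def noiseMeasure : Measure Noise :=
  Measure.infinitePi fun _ : ℕ => (expMeasure 1).prod (volume : Measure I)

/-- The state of the tagged customer after `k` jumps, started from `s`. -/
def path (lam : ℝ) (mu p : ℕ → ℝ) (s : TaggedState) (ω : Noise) : ℕ → TaggedState
  | 0 => s
  | k + 1 => jump lam mu p (ω k).2 (path lam mu p s ω k)

/-- Time spent in a state: exponential with the total rate out of the state (a standard
exponential `e` divided by the rate), and not counted after the departure. -/
def holdingTime (lam : ℝ) (mu p : ℕ → ℝ) (e : ℝ) : TaggedState → ℝ≥0∞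
  | none => 0
  | some (_, m) => ENNReal.ofReal (e / totalRate lam mu p m)

/-- Remaining time of the tagged customer in the system, started from state `s`. -/
def sojournTime (lam : ℝ) (mu p : ℕ → ℝ) (s : TaggedState) (ω : Noise) : ℝ≥0∞ :=
  ∑' k : ℕ, holdingTime lam mu p (ω k).1 (path lam mu p s ω k)

/-- The generalized waiting time `W(n, m; p)`: expected remaining time in the system of a tagged
customer with `n` customers in front and `m` in total, when future arrivals follow `p`. The
expectation is finite when `n < m` and the service rates `mu 1, mu 2, …` are bounded below by a
positive number. -/
def waitGen (lam : ℝ) (mu p : ℕ → ℝ) (n m : ℕ) : ℝ :=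
  (∫⁻ ω, sojournTime lam mu p (some (n, m)) ω ∂noiseMeasure).toReal

/-- The delay function `W(n; p)`: expected time in the system of a customer who finds `n`
customers upon arrival and joins, when all other customers follow `p`. -/
def delay (lam : ℝ) (mu p : ℕ → ℝ) (n : ℕ) : ℝ := waitGen lam mu p n (n + 1)

/-! ### Strategies and equilibria -/

/-- A (mixed) strategy: `p n` is the probability of joining when `n` customers are found. -/
def IsStrategy (p : ℕ → ℝ) : Prop := ∀ n, p n ∈ Set.Icc (0 : ℝ) 1

/-- The first state in which `p` prescribes balking (used when there is such a state). -/
def balkState (p : ℕ → ℝ) : ℕ := sInf {n | p n = 0}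

/-- Recurrent class equilibrium: a strategy that balks at some state and is a best response to
itself in every state of the recurrent class `{0, …, balkState p}`. Here `Rt` is the reward
divided by the waiting cost per unit time. -/
def IsRecurrentClassEquilibrium (lam : ℝ) (mu : ℕ → ℝ) (Rt : ℝ) (p : ℕ → ℝ) : Prop :=
  IsStrategy p ∧ (∃ n, p n = 0) ∧
    ∀ n ≤ balkState p,
      (p n = 0 → Rt - delay lam mu p n ≤ 0) ∧
      (p n = 1 → 0 ≤ Rt - delay lam mu p n) ∧
      (p n ∈ Set.Ioo (0 : ℝ) 1 → Rt - delay lam mu p n = 0)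

/-- The pure threshold strategy with threshold `n₀`: join iff at most `n₀ - 1` are present. -/
def pureThreshold (n₀ : ℕ) : ℕ → ℝ := fun n => if n < n₀ then 1 else 0

/-- The mixed threshold strategy given by a real `x > 0`: join below `⌊x⌋`, join with probability
`x - ⌊x⌋` at `⌊x⌋`, and balk above. -/
def mixedThreshold (x : ℝ) : ℕ → ℝ := fun n =>
  if n < ⌊x⌋₊ then 1 else if n = ⌊x⌋₊ then x - (⌊x⌋₊ : ℝ) else 0

/-- The threshold service policy: rate `muL` with at most `T` customers, `muH` with more. -/
def thresholdRate (T : ℕ) (muL muH : ℝ) : ℕ → ℝ := fun n => if n ≤ T then muL else muH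

end

end ObservableQueue

open ObservableQueue

/-! Everything follows from the first-step equations `waitGen_eq`. Write W_q for the wait when
customers join below N, join with probability q at N, and balk above (`stepStrategy`). For (1), take
N = n̂₀ - 1. At q = 0 nobody joins at N + 1 > T, so W_0(N, N+1) = 1/μ_h + W_0(N-1, N) > R̃; at q = 1
the strategy is p̃(n̂₀) and the wait is below R̃. The wait is continuous in q
(`continuousOn_waitGen_stepStrategy`), so some q in (0, 1) gives indifference at N. Joining below N
stays optimal: arrivals behind the tagged customer can only speed up service, so W_q ≤ W_0
(`waitGen_stepStrategy_le`), and W_0 ≤ R̃ there because p̃(n̂₀ - 1) is an equilibrium. Balking at N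
+ 1 is automatic, one more service being needed than at N. For (2), take N = R̃μ_l - 1 < T. At most
N + 1 ≤ T customers are ever present, all services are slow, and W_q(n, n+1) = (n+1)/μ_l whatever q
is; this equals R̃ at n = N. -/

namespace ObservableQueue

open MeasureTheory ProbabilityTheory
open scoped ENNReal unitInterval

/-! ### Expectation of a standard exponential variable -/

/-- On x ≥ 0, x times the Gamma(1, 1) density is the Gamma(2, 1) density, which has mass 1. -/
lemma lintegral_ofReal_expMeasure : ∫⁻ x, ENNReal.ofReal x ∂(expMeasure 1) = 1 := by
  have hm : Measurable (gammaPDF 1 1) := (measurable_gammaPDFReal 1 1).ennreal_ofReal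
  rw [expMeasure, gammaMeasure,
    lintegral_withDensity_eq_lintegral_mul _ hm
      ENNReal.measurable_ofReal,
    ← lintegral_gammaPDF_eq_one (a := 2) (r := 1) two_pos one_pos]
  refine lintegral_congr fun x => ?_
  rcases lt_or_ge x 0 with hx | hx
  · simp [gammaPDF_of_neg hx, ENNReal.ofReal_of_nonpos hx.le]
  · have h2 : Real.Gamma 2 = 1 := Real.Gamma_two
    rw [Pi.mul_apply, gammaPDF_of_nonneg hx, gammaPDF_of_nonneg hx,
      ← ENNReal.ofReal_mul (by simp; positivity)]
    congr 1
    norm_num [h2, Real.Gamma_one]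
    ring

/-! ### Splitting off the first coordinate of an infinite product -/

/-- Prepend a value to a sequence. -/
def consSeq {α : Type*} (z : α × (ℕ → α)) : ℕ → α
  | 0 => z.1
  | k + 1 => z.2 k

lemma measurable_consSeq {α : Type*} [MeasurableSpace α] :
    Measurable (consSeq : α × (ℕ → α) → ℕ → α) := by
  refine measurable_pi_lambda _ fun k => ?_
  cases k with
  | zero => exact measurable_fst
  | succ k => exact (measurable_pi_apply k).comp measurable_snd

/-- This is the source of the Markov property: the noise after the first jump is a copy of the whole
noise, independent of the first coordinate. It suffices to compare finite boxes, whose preimages are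
rectangles. -/
lemma map_consSeq_infinitePi {α : Type*} [MeasurableSpace α] (ν : Measure α)
    [IsProbabilityMeasure ν] :
    (ν.prod (Measure.infinitePi fun _ : ℕ => ν)).map consSeq =
      Measure.infinitePi fun _ : ℕ => ν := by
  refine Measure.eq_infinitePi (fun _ => ν) fun s t ht => ?_
  rw [Measure.map_apply measurable_consSeq
    (MeasurableSet.pi s.countable_toSet fun i _ => ht i)]
  classical
  have hpre : (consSeq ⁻¹' (s : Set ℕ).pi t : Set (α × (ℕ → α))) =
      (if 0 ∈ s then t 0 else Set.univ) ×ˢ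
        ((s.preimage Nat.succ Nat.succ_injective.injOn : Finset ℕ) : Set ℕ).pi
          (fun k => t (k + 1)) := by
    ext ⟨a, ω⟩
    simp only [Set.mem_preimage, Set.mem_pi, Set.mem_prod, Finset.mem_coe, Finset.mem_preimage]
    constructor
    · intro h
      refine ⟨?_, fun k hk => h (k + 1) hk⟩
      split_ifs with h0
      · exact h 0 h0
      · trivial
    · rintro ⟨h0, h1⟩ i hi
      cases i with
      | zero => rw [if_pos hi] at h0; exact h0
      | succ k => exact h1 k hi
  rw [hpre, Measure.prod_prod, Measure.infinitePi_pi (fun _ => ν) (fun i _ => ht (i + 1))]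
  rw [Finset.prod_preimage' Nat.succ s Nat.succ_injective.injOn (fun i => ν (t i))]
  by_cases h0 : 0 ∈ s
  · rw [if_pos h0, ← Finset.mul_prod_erase s _ h0]
    congr 2
    ext i
    cases i <;> simp
  · rw [if_neg h0, measure_univ, one_mul]
    congr 1
    ext i
    cases i <;> simp [h0]

/-! ### The first-step equation -/

instance : IsProbabilityMeasure (expMeasure 1) := isProbabilityMeasure_expMeasure one_pos

instance : IsProbabilityMeasure noiseMeasure := by unfold noiseMeasure; infer_instance

variable {lam : ℝ} {mu p : ℕ → ℝ}

lemma path_consSeq (s : TaggedState) (a : ℝ × I) (ω : Noise) (k : ℕ) :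
    path lam mu p s (consSeq (a, ω)) (k + 1) = path lam mu p (jump lam mu p a.2 s) ω k := by
  induction k with
  | zero => rfl
  | succ k ih => rw [path, ih]; rfl

lemma sojournTime_consSeq (s : TaggedState) (a : ℝ × I) (ω : Noise) :
    sojournTime lam mu p s (consSeq (a, ω)) =
      holdingTime lam mu p a.1 s + sojournTime lam mu p (jump lam mu p a.2 s) ω := by
  rw [sojournTime, tsum_eq_zero_add' ENNReal.summable]
  simp only [path_consSeq]
  rfl

lemma measurable_holdingTime (s : TaggedState) :
    Measurable fun e => holdingTime lam mu p e s := by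
  rcases s with _ | ⟨n, m⟩
  · exact measurable_const
  · exact ENNReal.measurable_ofReal.comp (measurable_id.div_const _)

lemma measurable_comp_jump {β : Type*} [MeasurableSpace β] (f : TaggedState → β)
    (s : TaggedState) : Measurable fun u => f (jump lam mu p u s) := by
  rcases s with _ | ⟨n, m⟩
  · simp only [jump]
    exact measurable_const
  · simp only [jump, apply_ite f]
    exact Measurable.ite (measurable_subtype_coe measurableSet_Iio) measurable_const
      measurable_const

lemma measurable_path (s : TaggedState) (k : ℕ) :
    Measurable[_, ⊤] fun ω => path lam mu p s ω k := by
  let _ : MeasurableSpace TaggedState := ⊤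
  induction k with
  | zero => exact measurable_const
  | succ k ih =>
    have h : Measurable fun z : I × TaggedState => jump lam mu p z.1 z.2 :=
      measurable_from_prod_countable_left fun s => measurable_comp_jump id s
    exact h.comp ((measurable_snd.comp (measurable_pi_apply k)).prodMk ih)

lemma measurable_sojournTime (s : TaggedState) : Measurable (sojournTime lam mu p s) := by
  let _ : MeasurableSpace TaggedState := ⊤
  refine Measurable.tsum fun k => ?_
  have h : Measurable fun z : ℝ × TaggedState => holdingTime lam mu p z.1 z.2 :=
    measurable_from_prod_countable_left fun s => measurable_holdingTime s
  exact h.comp ((measurable_fst.comp (measurable_pi_apply k)).prodMk (measurable_path s k))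

/-- Expected remaining time in the system, with values in `[0, ∞]`. -/
noncomputable def expectedSojourn (lam : ℝ) (mu p : ℕ → ℝ) (s : TaggedState) : ℝ≥0∞ :=
  ∫⁻ ω, sojournTime lam mu p s ω ∂noiseMeasure

/-- First-step analysis, done in `[0, ∞]` so that no finiteness is needed yet. -/
lemma expectedSojourn_eq (s : TaggedState) :
    expectedSojourn lam mu p s = (∫⁻ e, holdingTime lam mu p e s ∂(expMeasure 1)) +
      ∫⁻ u : I, expectedSojourn lam mu p (jump lam mu p u s) := by
  have hH := measurable_holdingTime (lam := lam) (mu := mu) (p := p) s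
  have hJ := measurable_comp_jump (lam := lam) (mu := mu) (p := p)
    (expectedSojourn lam mu p) s
  have hmap := map_consSeq_infinitePi ((expMeasure 1).prod (volume : Measure I))
  have hS := measurable_sojournTime (lam := lam) (mu := mu) (p := p) s
  calc expectedSojourn lam mu p s
      = ∫⁻ z, sojournTime lam mu p s (consSeq z)
          ∂(((expMeasure 1).prod (volume : Measure I)).prod noiseMeasure) := by
        rw [expectedSojourn, noiseMeasure]
        conv_lhs => rw [← hmap]
        rw [lintegral_map hS measurable_consSeq]
    _ = ∫⁻ a, ∫⁻ ω, sojournTime lam mu p s (consSeq (a, ω)) ∂noiseMeasure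
          ∂((expMeasure 1).prod (volume : Measure I)) :=
        lintegral_prod _ (hS.comp measurable_consSeq).aemeasurable
    _ = ∫⁻ a, (holdingTime lam mu p a.1 s + expectedSojourn lam mu p (jump lam mu p a.2 s))
          ∂((expMeasure 1).prod (volume : Measure I)) := by
        refine lintegral_congr fun a => ?_
        simp only [sojournTime_consSeq]
        rw [lintegral_add_left measurable_const, lintegral_const, measure_univ, mul_one]
        rfl
    _ = _ := by
        refine (lintegral_add_left (f := fun a : ℝ × I => holdingTime lam mu p a.1 s)
          (hH.comp measurable_fst) _).trans ?_
        congr 1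
        · exact measurePreserving_fst.lintegral_comp hH
        · exact measurePreserving_snd.lintegral_comp hJ

lemma expectedSojourn_none : expectedSojourn lam mu p none = 0 := by
  have hp : ∀ ω k, path lam mu p none ω k = none := by
    intro ω k
    induction k with
    | zero => rfl
    | succ k ih => rw [path, ih]; rfl
  simp [expectedSojourn, sojournTime, hp, holdingTime]

/-- State of the tagged customer after a service completion in state `(n, m)`. -/
def afterService (n m : ℕ) : TaggedState := if n = 0 then none else some (n - 1, m - 1)

lemma lintegral_ite_lt (c : ℝ) (hc0 : 0 ≤ c) (hc1 : c ≤ 1) (a b : ℝ≥0∞) :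
    ∫⁻ u : I, (if (u : ℝ) < c then a else b) =
      ENNReal.ofReal c * a + ENNReal.ofReal (1 - c) * b := by
  have hs : MeasurableSet {u : I | (u : ℝ) < c} := measurable_subtype_coe measurableSet_Iio
  have e1 : {u : I | (u : ℝ) < c} = Set.Iio (⟨c, hc0, hc1⟩ : I) := rfl
  have e2 : {u : I | (u : ℝ) < c}ᶜ = Set.Ici (⟨c, hc0, hc1⟩ : I) := by
    ext u; simp [← Subtype.coe_le_coe]
  rw [← lintegral_add_compl _ hs,
    setLIntegral_congr_fun (g := fun _ => a) hs
      (fun u hu => by simp only [if_pos (show (u : ℝ) < c from hu)]),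
    setLIntegral_congr_fun (g := fun _ => b) hs.compl
      (fun u hu => by simp only [if_neg (show ¬ (u : ℝ) < c from hu)]),
    setLIntegral_const, setLIntegral_const, e2, e1, unitInterval.volume_Iio,
    unitInterval.volume_Ici, mul_comm a, mul_comm b]

lemma expectedSojourn_some {n m : ℕ} (hlam : 0 ≤ lam) (hp : 0 ≤ p m) (hmu : 0 < mu m) :
    expectedSojourn lam mu p (some (n, m)) =
      ENNReal.ofReal (1 / (lam * p m + mu m)) +
        (ENNReal.ofReal (lam * p m / (lam * p m + mu m)) *
            expectedSojourn lam mu p (some (n, m + 1)) +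
          ENNReal.ofReal (mu m / (lam * p m + mu m)) *
            expectedSojourn lam mu p (afterService n m)) := by
  have h0 : 0 ≤ lam * p m := mul_nonneg hlam hp
  have hr : 0 < lam * p m + mu m := by linarith
  rw [expectedSojourn_eq]
  congr 1
  · simp only [holdingTime, totalRate, div_eq_inv_mul]
    simp_rw [ENNReal.ofReal_mul (inv_nonneg.2 hr.le)]
    rw [lintegral_const_mul _ ENNReal.measurable_ofReal, lintegral_ofReal_expMeasure]
    simp
  · have h := lintegral_ite_lt (lam * p m / (lam * p m + mu m)) (by positivity)
      ((div_le_one hr).2 (by linarith)) (expectedSojourn lam mu p (some (n, m + 1)))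
      (expectedSojourn lam mu p (afterService n m))
    rw [one_sub_div hr.ne', add_sub_cancel_left] at h
    rw [← h]
    refine lintegral_congr fun u => ?_
    by_cases hu : (u : ℝ) < lam * p m / (lam * p m + mu m)
    · rw [if_pos hu, jump, if_pos (show (u : ℝ) < lam * p m / totalRate lam mu p m from hu)]
    · rw [if_neg hu, jump, if_neg (show ¬ (u : ℝ) < lam * p m / totalRate lam mu p m from hu)]
      rfl

/-! ### The linear equations of the delay function -/

/-- Induction along the jumps of the chain when nobody joins at `M` or above. -/
lemma jump_induction (M : ℕ) {P : ℕ → ℕ → Prop}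
    (step : ∀ n m, (∀ k, n = k + 1 → ∀ m', P k m') → (m < M → P n (m + 1)) → P n m) :
    ∀ n m, P n m := by
  -- A service lowers `n`; an arrival keeps `n` and brings `m` closer to `M`, a gap bounded by `d`.
  -- The order is thus lexicographic.
  have aux : ∀ n, (∀ k, n = k + 1 → ∀ m', P k m') → ∀ d m, M ≤ m + d → P n m := by
    intro n hn d
    induction d with
    | zero => exact fun m hm => step n m hn fun h => absurd h (by omega)
    | succ d ih => exact fun m hm => step n m hn fun _ => ih (m + 1) (by omega)
  intro n
  induction n with
  | zero => exact fun m => aux 0 (fun k hk => by omega) M m (by omega)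
  | succ n ih =>
    refine fun m => aux (n + 1) (fun k hk => ?_) M m (by omega)
    obtain rfl : k = n := by omega
    exact ih

/-- Expected remaining time after a service completion in state `(n, m)`. -/
noncomputable def waitAfter (lam : ℝ) (mu p : ℕ → ℝ) (n m : ℕ) : ℝ :=
  (expectedSojourn lam mu p (afterService n m)).toReal

lemma waitAfter_zero (m : ℕ) : waitAfter lam mu p 0 m = 0 := by
  simp [waitAfter, afterService, expectedSojourn_none]

lemma waitAfter_succ (n m : ℕ) :
    waitAfter lam mu p (n + 1) m = waitGen lam mu p n (m - 1) := by
  simp [waitAfter, afterService, waitGen, expectedSojourn]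

lemma waitGen_nonneg (n m : ℕ) : 0 ≤ waitGen lam mu p n m := ENNReal.toReal_nonneg

/-- Needed before passing to real numbers, since `toReal` sends `∞` to 0. -/
lemma expectedSojourn_ne_top (hlam : 0 ≤ lam) (hmu : ∀ m, 0 < mu m) (hp : ∀ m, 0 ≤ p m) {M : ℕ}
    (hM : ∀ m, M ≤ m → p m = 0) (n m : ℕ) : expectedSojourn lam mu p (some (n, m)) ≠ ∞ := by
  induction n, m using jump_induction M with | step n m hn hm
  rw [expectedSojourn_some hlam (hp m) (hmu m)]
  refine ENNReal.add_ne_top.2 ⟨ENNReal.ofReal_ne_top, ENNReal.add_ne_top.2 ⟨?_, ?_⟩⟩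
  · rcases lt_or_ge m M with h | h
    · exact ENNReal.mul_ne_top ENNReal.ofReal_ne_top (hm h)
    · simp [hM m h]
  · refine ENNReal.mul_ne_top ENNReal.ofReal_ne_top ?_
    cases n with
    | zero => simp [afterService, expectedSojourn_none]
    | succ k => simpa [afterService] using hn k rfl (m - 1)

lemma waitGen_eq (hlam : 0 ≤ lam) (hmu : ∀ m, 0 < mu m) (hp : ∀ m, 0 ≤ p m) {M : ℕ}
    (hM : ∀ m, M ≤ m → p m = 0) (n m : ℕ) :
    (lam * p m + mu m) * waitGen lam mu p n m =
      1 + lam * p m * waitGen lam mu p n (m + 1) + mu m * waitAfter lam mu p n m := by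
  have hfin := expectedSojourn_ne_top hlam hmu hp hM
  have h0 : 0 ≤ lam * p m := mul_nonneg hlam (hp m)
  have hr : 0 < lam * p m + mu m := by linarith [hmu m]
  have ha : expectedSojourn lam mu p (afterService n m) ≠ ∞ := by
    unfold afterService
    split_ifs
    · simp [expectedSojourn_none]
    · exact hfin _ _
  have h : waitGen lam mu p n m = 1 / (lam * p m + mu m) +
      (lam * p m / (lam * p m + mu m) * waitGen lam mu p n (m + 1) +
        mu m / (lam * p m + mu m) * waitAfter lam mu p n m) := by
    change (expectedSojourn lam mu p (some (n, m))).toReal = _ + (_ *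
      (expectedSojourn lam mu p (some (n, m + 1))).toReal + _ *
      (expectedSojourn lam mu p (afterService n m)).toReal)
    have m1 := ENNReal.mul_ne_top
      (ENNReal.ofReal_ne_top (r := lam * p m / (lam * p m + mu m))) (hfin n (m + 1))
    have m2 := ENNReal.mul_ne_top
      (ENNReal.ofReal_ne_top (r := mu m / (lam * p m + mu m))) ha
    rw [expectedSojourn_some hlam (hp m) (hmu m), ENNReal.toReal_add ENNReal.ofReal_ne_top
      (ENNReal.add_ne_top.2 ⟨m1, m2⟩), ENNReal.toReal_add m1 m2, ENNReal.toReal_mul,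
      ENNReal.toReal_mul, ENNReal.toReal_ofReal (by positivity),
      ENNReal.toReal_ofReal (by positivity),
      ENNReal.toReal_ofReal (div_nonneg (hmu m).le hr.le)]
  rw [h]
  field_simp
  ring

/-- More customers in front mean a longer wait. -/
lemma waitGen_le_succ_left (hlam : 0 ≤ lam) (hmu : ∀ m, 0 < mu m) (hp : ∀ m, 0 ≤ p m) {M : ℕ}
    (hM : ∀ m, M ≤ m → p m = 0) (n m : ℕ) :
    waitGen lam mu p n m ≤ waitGen lam mu p (n + 1) m := by
  induction n, m using jump_induction M with | step n m hn hm
  have h0 : 0 ≤ lam * p m := mul_nonneg hlam (hp m)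
  refine le_of_mul_le_mul_left ?_ (show 0 < lam * p m + mu m by linarith [hmu m])
  rw [waitGen_eq hlam hmu hp hM, waitGen_eq hlam hmu hp hM, waitAfter_succ]
  have h1 : lam * p m * waitGen lam mu p n (m + 1) ≤
      lam * p m * waitGen lam mu p (n + 1) (m + 1) := by
    rcases lt_or_ge m M with h | h
    · exact mul_le_mul_of_nonneg_left (hm h) h0
    · simp [hM m h]
  have h2 : mu m * waitAfter lam mu p n m ≤ mu m * waitGen lam mu p n (m - 1) := by
    refine mul_le_mul_of_nonneg_left ?_ (hmu m).le
    cases n with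
    | zero => rw [waitAfter_zero]; exact waitGen_nonneg _ _
    | succ k => rw [waitAfter_succ]; exact hn k rfl _
  linarith

/-- When the service rate increases with the number present, more customers behind mean a
shorter wait. -/
lemma waitGen_succ_right_le (hlam : 0 ≤ lam) (hmu : ∀ m, 0 < mu m) (hmono : Monotone mu)
    (hp : ∀ m, 0 ≤ p m) {M : ℕ} (hM : ∀ m, M ≤ m → p m = 0) (n m : ℕ) :
    waitGen lam mu p n (m + 1) ≤ waitGen lam mu p n m := by
  induction n, m using jump_induction M with | step n m hn hm
  have h0 : 0 ≤ lam * p m := mul_nonneg hlam (hp m)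
  have hr : 0 < lam * p m + mu (m + 1) := by linarith [hmu (m + 1)]
  have e1 := waitGen_eq hlam hmu hp hM n m
  have e2 := waitGen_eq hlam hmu hp hM n (m + 1)
  have h1 : 0 ≤ lam * p (m + 1) *
      (waitGen lam mu p n (m + 1) - waitGen lam mu p n (m + 1 + 1)) := by
    rcases lt_or_ge m M with h | h
    · exact mul_nonneg (mul_nonneg hlam (hp _)) (sub_nonneg.2 (hm h))
    · simp [hM (m + 1) (by omega)]
  have h2 : 0 ≤ mu m * (waitAfter lam mu p n m - waitAfter lam mu p n (m + 1)) := by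
    refine mul_nonneg (hmu m).le (sub_nonneg.2 ?_)
    cases n with
    | zero => simp [waitAfter_zero]
    | succ k =>
      rw [waitAfter_succ, waitAfter_succ]
      cases m with
      -- The unphysical case `m = 0`: truncated subtraction makes both successor states equal.
      | zero => rfl
      | succ m => exact hn k rfl m
  have h3 : 0 ≤ (mu (m + 1) - mu m) *
      (waitGen lam mu p n m - waitAfter lam mu p n (m + 1)) := by
    refine mul_nonneg (sub_nonneg.2 (hmono m.le_succ)) (sub_nonneg.2 ?_)
    cases n with
    | zero => rw [waitAfter_zero]; exact waitGen_nonneg _ _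
    | succ k => rw [waitAfter_succ]; exact waitGen_le_succ_left hlam hmu hp hM k m
  refine sub_nonneg.1 (nonneg_of_mul_nonneg_right ?_ hr)
  -- Subtracting the two first-step equations writes `lam * p m + mu (m + 1)` times the difference
  -- of the waits as the sum of the three nonnegative terms.
  linear_combination h1 + h2 + h3 + e2 - e1

/-! ### Joining below `N` and with probability `q` at `N` -/

/-- Join below `N`, join with probability `q` at `N`, balk above. -/
noncomputable def stepStrategy (N : ℕ) (q : ℝ) : ℕ → ℝ := fun n =>
  if n < N then 1 else if n = N then q else 0

section stepStrategy

variable {N : ℕ} {q : ℝ}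

lemma stepStrategy_of_lt {n : ℕ} (h : n < N) : stepStrategy N q n = 1 := if_pos h

lemma stepStrategy_self : stepStrategy N q N = q := by simp [stepStrategy]

lemma stepStrategy_of_gt {n : ℕ} (h : N < n) : stepStrategy N q n = 0 := by
  rw [stepStrategy, if_neg (by omega), if_neg (by omega)]

lemma stepStrategy_of_ne {n : ℕ} (h : n ≠ N) (q' : ℝ) :
    stepStrategy N q n = stepStrategy N q' n := by
  simp [stepStrategy, h]

lemma isStrategy_stepStrategy (hq : q ∈ Set.Icc (0 : ℝ) 1) : IsStrategy (stepStrategy N q) := by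
  intro n
  unfold stepStrategy
  split_ifs <;> simp_all

lemma stepStrategy_zero : stepStrategy N 0 = pureThreshold N := by
  ext n
  simp [stepStrategy, pureThreshold]

lemma stepStrategy_one : stepStrategy N 1 = pureThreshold (N + 1) := by
  ext n
  simp only [stepStrategy, pureThreshold, Nat.lt_succ_iff_lt_or_eq]
  split_ifs <;> grind

lemma mixedThreshold_eq_stepStrategy {x : ℝ} (hx : x ∈ Set.Ioo (N : ℝ) (N + 1)) :
    mixedThreshold x = stepStrategy N (x - N) := by
  have hfl : ⌊x⌋₊ = N := (Nat.floor_eq_iff (N.cast_nonneg.trans hx.1.le)).2 ⟨hx.1.le, hx.2⟩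
  ext n
  rw [mixedThreshold, stepStrategy, hfl]

lemma balkState_stepStrategy (hq : q ≠ 0) : balkState (stepStrategy N q) = N + 1 := by
  refine le_antisymm (Nat.sInf_le (stepStrategy_of_gt N.lt_succ_self)) ?_
  refine le_csInf ⟨N + 1, stepStrategy_of_gt N.lt_succ_self⟩ fun n hn => ?_
  by_contra! h
  rcases Nat.lt_succ_iff_lt_or_eq.1 h with h | rfl
  · exact one_ne_zero ((stepStrategy_of_lt h).symm.trans hn)
  · exact hq (stepStrategy_self.symm.trans hn)

lemma balkState_pureThreshold : balkState (pureThreshold N) = N := by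
  refine le_antisymm (Nat.sInf_le (by simp [pureThreshold])) ?_
  refine le_csInf ⟨N, by simp [pureThreshold]⟩ fun n hn => ?_
  by_contra! h
  exact one_ne_zero ((if_pos h).symm.trans hn)

lemma waitGen_stepStrategy_eq (hlam : 0 ≤ lam) (hmu : ∀ m, 0 < mu m)
    (hq : q ∈ Set.Icc (0 : ℝ) 1) (n m : ℕ) :
    (lam * stepStrategy N q m + mu m) * waitGen lam mu (stepStrategy N q) n m =
      1 + lam * stepStrategy N q m * waitGen lam mu (stepStrategy N q) n (m + 1) +
        mu m * waitAfter lam mu (stepStrategy N q) n m :=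
  waitGen_eq hlam hmu (fun m => (isStrategy_stepStrategy hq m).1) (M := N + 1)
    (fun _ hm => stepStrategy_of_gt hm) n m

/-- Finitely many first-step equations express the wait as a rational function of `q` with
denominators positive on [0, 1]. -/
lemma continuousOn_waitGen_stepStrategy (hlam : 0 ≤ lam) (hmu : ∀ m, 0 < mu m) (n m : ℕ) :
    ContinuousOn (fun q => waitGen lam mu (stepStrategy N q) n m) (Set.Icc 0 1) := by
  refine jump_induction (N + 1)
    (P := fun n m => ContinuousOn (fun q => waitGen lam mu (stepStrategy N q) n m) (Set.Icc 0 1))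
    (fun n m hn hm => ?_) n m
  have hpos : ∀ q ∈ Set.Icc (0 : ℝ) 1, lam * stepStrategy N q m + mu m ≠ 0 := fun q hq =>
    (add_pos_of_nonneg_of_pos (mul_nonneg hlam (isStrategy_stepStrategy hq m).1) (hmu m)).ne'
  have hc : Continuous fun q => stepStrategy N q m := by
    unfold stepStrategy
    split_ifs <;> fun_prop
  have hup : ContinuousOn (fun q => lam * stepStrategy N q m *
      waitGen lam mu (stepStrategy N q) n (m + 1)) (Set.Icc 0 1) := by
    rcases lt_or_ge m (N + 1) with h | h
    · exact (continuous_const.mul hc).continuousOn.mul (hm h)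
    · simp only [stepStrategy_of_gt (show N < m from h), mul_zero, zero_mul]
      exact continuousOn_const
  have hafter : ContinuousOn (fun q => waitAfter lam mu (stepStrategy N q) n m)
      (Set.Icc 0 1) := by
    cases n with
    | zero => simp only [waitAfter_zero]; exact continuousOn_const
    | succ k => simp only [waitAfter_succ]; exact hn k rfl _
  have h := ((continuousOn_const (c := (1 : ℝ))).add hup |>.add
    ((continuousOn_const (c := mu m)).mul hafter)).div
    ((continuous_const.mul hc).add (continuous_const (y := mu m))).continuousOn hpos
  refine h.congr fun q hq => ?_
  exact (eq_div_iff (hpos q hq)).2 (by rw [mul_comm]; exact waitGen_stepStrategy_eq hlam hmu hq n m)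

/-- Joins at `N` shorten the wait. -/
lemma waitGen_stepStrategy_le (hlam : 0 ≤ lam) (hmu : ∀ m, 0 < mu m) (hmono : Monotone mu)
    (hq : q ∈ Set.Icc (0 : ℝ) 1) (n m : ℕ) :
    waitGen lam mu (stepStrategy N q) n m ≤ waitGen lam mu (stepStrategy N 0) n m := by
  induction n, m using jump_induction (N + 1) with | step n m hn hm
  have hz : (0 : ℝ) ∈ Set.Icc (0 : ℝ) 1 := by simp
  have h0 : 0 ≤ lam * stepStrategy N q m := mul_nonneg hlam (isStrategy_stepStrategy hq m).1
  have e := waitGen_stepStrategy_eq (N := N) hlam hmu hq n m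
  have e0 := waitGen_stepStrategy_eq (N := N) hlam hmu hz n m
  have hup : lam * stepStrategy N q m * waitGen lam mu (stepStrategy N q) n (m + 1) ≤
      lam * stepStrategy N q m * waitGen lam mu (stepStrategy N 0) n (m + 1) := by
    rcases lt_or_ge m (N + 1) with h | h
    · exact mul_le_mul_of_nonneg_left (hm h) h0
    · simp [stepStrategy_of_gt (show N < m from h)]
  have hafter : mu m * waitAfter lam mu (stepStrategy N q) n m ≤
      mu m * waitAfter lam mu (stepStrategy N 0) n m := by
    refine mul_le_mul_of_nonneg_left ?_ (hmu m).le
    cases n with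
    | zero => simp [waitAfter_zero]
    | succ k => rw [waitAfter_succ, waitAfter_succ]; exact hn k rfl _
  have hflip : lam * (stepStrategy N q m - stepStrategy N 0 m) *
      waitGen lam mu (stepStrategy N 0) n (m + 1) ≤
      lam * (stepStrategy N q m - stepStrategy N 0 m) *
      waitGen lam mu (stepStrategy N 0) n m := by
    refine mul_le_mul_of_nonneg_left (waitGen_succ_right_le hlam hmu hmono
      (fun m => (isStrategy_stepStrategy hz m).1) (M := N + 1)
      (fun _ hm => stepStrategy_of_gt hm) n m) (mul_nonneg hlam ?_)
    rcases eq_or_ne m N with rfl | h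
    · simpa [stepStrategy_self] using hq.1
    · simp [stepStrategy_of_ne h 0]
  refine le_of_mul_le_mul_left ?_ (add_pos_of_nonneg_of_pos h0 (hmu m))
  linarith

/-- With no joins at `m + 1`, the next event is a service. -/
lemma waitGen_stepStrategy_of_gt (hlam : 0 ≤ lam) (hmu : ∀ m, 0 < mu m)
    (hq : q ∈ Set.Icc (0 : ℝ) 1) {n m : ℕ} (hm : stepStrategy N q (m + 1) = 0) :
    waitGen lam mu (stepStrategy N q) (n + 1) (m + 1) =
      1 / mu (m + 1) + waitGen lam mu (stepStrategy N q) n m := by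
  have e := waitGen_stepStrategy_eq (N := N) hlam hmu hq (n + 1) (m + 1)
  rw [hm, waitAfter_succ, Nat.add_sub_cancel] at e
  have := (hmu (m + 1)).ne'
  field_simp
  linarith

lemma isRecurrentClassEquilibrium_stepStrategy {Rt : ℝ} (hlam : 0 ≤ lam) (hmu : ∀ m, 0 < mu m)
    (hq : q ∈ Set.Ioo (0 : ℝ) 1)
    (hlt : ∀ n < N, waitGen lam mu (stepStrategy N q) n (n + 1) ≤ Rt)
    (heq : waitGen lam mu (stepStrategy N q) N (N + 1) = Rt) :
    IsRecurrentClassEquilibrium lam mu Rt (stepStrategy N q) := by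
  have hq' : q ∈ Set.Icc (0 : ℝ) 1 := Set.Ioo_subset_Icc_self hq
  refine ⟨isStrategy_stepStrategy hq', ⟨N + 1, stepStrategy_of_gt N.lt_succ_self⟩, fun n hn => ?_⟩
  rw [balkState_stepStrategy hq.1.ne'] at hn
  unfold delay
  rcases lt_trichotomy n N with h | rfl | h
  · rw [stepStrategy_of_lt h]
    exact ⟨fun h => absurd h one_ne_zero, fun _ => sub_nonneg.2 (hlt n h), fun h => by simp at h⟩
  · simp [heq]
  · obtain rfl : n = N + 1 := by omega
    rw [stepStrategy_of_gt h]
    refine ⟨fun _ => ?_, fun h => absurd h zero_ne_one, fun h => by simp at h⟩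
    rw [waitGen_stepStrategy_of_gt hlam hmu hq' (stepStrategy_of_gt (by omega)), heq]
    have := one_div_pos.2 (hmu (N + 1 + 1))
    linarith

end stepStrategy

/-! ### The threshold service policy -/

section thresholdRate

variable {T : ℕ} {muL muH : ℝ}

lemma thresholdRate_pos (hmuL : 0 < muL) (hmu : muL < muH) (m : ℕ) :
    0 < thresholdRate T muL muH m := by
  unfold thresholdRate
  split_ifs <;> linarith

lemma monotone_thresholdRate (hmu : muL < muH) : Monotone (thresholdRate T muL muH) := by
  intro a b hab
  unfold thresholdRate
  split_ifs <;> first | omega | linarith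

/-- If `N < T`, every service with at most `N + 1` customers present is slow. -/
lemma waitGen_stepStrategy_slow {N : ℕ} {q : ℝ} (hlam : 0 ≤ lam) (hmuL : 0 < muL)
    (hmu : muL < muH) (hNT : N < T) (hq : q ∈ Set.Icc (0 : ℝ) 1) (n m : ℕ) (hnm : n < m)
    (hm : m ≤ N + 1) :
    waitGen lam (thresholdRate T muL muH) (stepStrategy N q) n m = ((n : ℝ) + 1) / muL := by
  revert hnm hm
  refine jump_induction (N + 1) (P := fun n m => n < m → m ≤ N + 1 →
    waitGen lam (thresholdRate T muL muH) (stepStrategy N q) n m = ((n : ℝ) + 1) / muL)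
    (fun n m hn hm hnm hmN => ?_) n m
  have h0 : 0 ≤ lam * stepStrategy N q m := mul_nonneg hlam (isStrategy_stepStrategy hq m).1
  have e := waitGen_stepStrategy_eq (N := N) hlam (thresholdRate_pos (T := T) hmuL hmu) hq n m
  have hup : lam * stepStrategy N q m *
      waitGen lam (thresholdRate T muL muH) (stepStrategy N q) n (m + 1) =
      lam * stepStrategy N q m * (((n : ℝ) + 1) / muL) := by
    rcases lt_or_ge m (N + 1) with h | h
    · rw [hm h (by omega) (by omega)]
    · simp [stepStrategy_of_gt (show N < m from h)]
  have hafter : waitAfter lam (thresholdRate T muL muH) (stepStrategy N q) n m = n / muL := by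
    cases n with
    | zero => simp [waitAfter_zero]
    | succ k =>
      rw [waitAfter_succ, hn k rfl _ (by omega) (by omega)]
      push_cast
      rfl
  have hrate : thresholdRate T muL muH m = muL := if_pos (by omega)
  rw [hup, hafter, hrate] at e
  -- The claimed value does not depend on `m`, so the arrival terms cancel.
  refine mul_left_cancel₀ (add_pos_of_nonneg_of_pos h0 hmuL).ne' (e.trans ?_)
  field_simp
  ring

end thresholdRate

end ObservableQueue

theorem mainTheorem6 (lam muL muH R C : ℝ) (T : ℕ)
    (hlam : 0 < lam) (hmuL : 0 < muL) (hmu : muL < muH) (hT : 0 < T)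
    (hR : 0 ≤ R) (hC : 0 < C) :
    (∀ n₀ : ℕ, T + 1 ≤ n₀ - 1 →
      IsRecurrentClassEquilibrium lam (thresholdRate T muL muH) (R / C)
        (pureThreshold (n₀ - 1)) →
      IsRecurrentClassEquilibrium lam (thresholdRate T muL muH) (R / C)
        (pureThreshold n₀) →
      R / C - 1 / muH <
        waitGen lam (thresholdRate T muL muH) (pureThreshold (n₀ - 1)) (n₀ - 2) (n₀ - 1) →
      waitGen lam (thresholdRate T muL muH) (pureThreshold n₀) (n₀ - 1) n₀ < R / C →
      ∃ x ∈ Set.Ioo ((n₀ : ℝ) - 1) (n₀ : ℝ),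
        IsRecurrentClassEquilibrium lam (thresholdRate T muL muH) (R / C)
          (mixedThreshold x)) ∧
    (∀ k : ℕ, 0 < k → k ≤ T → R / C * muL = (k : ℝ) →
      ∀ x ∈ Set.Ioo ((k : ℝ) - 1) (k : ℝ),
        IsRecurrentClassEquilibrium lam (thresholdRate T muL muH) (R / C)
          (mixedThreshold x)) := by
  have hpos := thresholdRate_pos (T := T) hmuL hmu
  refine ⟨fun n₀ hn₀ heq0 _ hlow hhigh => ?_, fun k hk hkT hRk x hx => ?_⟩
  · obtain ⟨N, rfl⟩ : ∃ N, n₀ = N + 2 := ⟨n₀ - 2, by omega⟩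
    simp only [show N + 2 - 1 = N + 1 by omega, Nat.add_sub_cancel] at hn₀ heq0 hlow hhigh
    rw [show N + 2 = N + 1 + 1 from rfl, ← stepStrategy_one] at hhigh
    have hz : (0 : ℝ) ∈ Set.Icc (0 : ℝ) 1 := by simp
    have hstart : R / C < waitGen lam (thresholdRate T muL muH) (stepStrategy (N + 1) 0)
        (N + 1) (N + 1 + 1) := by
      rw [waitGen_stepStrategy_of_gt hlam.le hpos hz (stepStrategy_of_gt (by omega)),
        stepStrategy_zero, thresholdRate, if_neg (by omega)]
      linarith
    -- The primed version is used because the value at `q = 0` is the larger one.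
    obtain ⟨q, hq, hqeq⟩ := intermediate_value_Ioo' zero_le_one
      (continuousOn_waitGen_stepStrategy (N := N + 1) hlam.le hpos (N + 1) (N + 1 + 1))
      ⟨hhigh, hstart⟩
    refine ⟨((N + 1 : ℕ) : ℝ) + q, ⟨?_, ?_⟩, ?_⟩
    · push_cast; linarith [hq.1]
    · push_cast; linarith [hq.2]
    rw [mixedThreshold_eq_stepStrategy (N := N + 1) ⟨by linarith [hq.1], by linarith [hq.2]⟩,
      add_sub_cancel_left]
    refine isRecurrentClassEquilibrium_stepStrategy hlam.le hpos hq (fun n hn => ?_) hqeq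
    -- Compare with `q = 0`, which is the equilibrium of `heq0`.
    refine (waitGen_stepStrategy_le hlam.le hpos (monotone_thresholdRate hmu)
      (Set.Ioo_subset_Icc_self hq) n (n + 1)).trans ?_
    rw [stepStrategy_zero]
    exact sub_nonneg.1 ((heq0.2.2 n (by rw [balkState_pureThreshold]; exact hn.le)).2.1
      (if_pos hn))
  · obtain ⟨N, rfl⟩ : ∃ N, k = N + 1 := ⟨k - 1, by omega⟩
    push_cast at hRk hx
    rw [add_sub_cancel_right] at hx
    have hq : x - N ∈ Set.Ioo (0 : ℝ) 1 := ⟨by linarith [hx.1], by linarith [hx.2]⟩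
    have hRt : R / C = ((N : ℝ) + 1) / muL := (eq_div_iff hmuL.ne').2 hRk
    have hslow := waitGen_stepStrategy_slow (N := N) hlam.le hmuL hmu hkT
      (Set.Ioo_subset_Icc_self hq)
    rw [mixedThreshold_eq_stepStrategy hx]
    refine isRecurrentClassEquilibrium_stepStrategy hlam.le hpos hq (fun n hn => ?_) ?_
    · rw [hslow n (n + 1) n.lt_succ_self (by omega), hRt]
      have : (n : ℝ) ≤ N := by exact_mod_cast hn.le
      gcongr
    · rw [hslow N (N + 1) N.lt_succ_self le_rfl, hRt]
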